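/- Let $n\ge 1$ and let $\mathbb{RM}(n)$ be a perfect matching of $[2n]=\{1,\dots,2n\}$ chosen uniformly at random among all perfect matchings of $[2n]$ (partitions of $[2n]$ into $n$ two-element sets, called edges). For $1\le k\le 2n$ let $X_k$ be the number of edges of $\mathbb{RM}(n)$ with one endpoint in $[k]=\{1,\dots,k\}$ and the other in $[2n]\setminus[k]$ (the sequence $(X_k)_{k=1}^{2n}$ is called the sockuence), and let $\bar X=\frac1{2n}\sum_{k=1}^{2n}X_k$ be its average value. Then, for every $n\ge1$, $$\mathbb{E}\,\bar X=\frac{2n+1}{6},$$ and, for every real-valued function $\omega$ with $\omega(n)\to\infty$ as $n\to\infty$, $$\lim_{n\to\infty}\mathbb{P}\left(\left|\bar X-\frac n3\right|\le\omega(n)\sqrt n\right)=1.$$ -/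

import Mathlib

open Filter Topology

namespace Sockuence

/-- The perfect matchings of `[2n]`: sets of two-element subsets (edges) of the vertex set such that
every vertex lies in exactly one edge. The vertices `1, …, 2n` are represented by the elements
`0, …, 2n - 1` of `Fin (2 * n)`, in the same order. -/
def perfectMatchings (n : ℕ) : Finset (Finset (Finset (Fin (2 * n)))) :=
  {M | (∀ e ∈ M, e.card = 2) ∧ ∀ v : Fin (2 * n), {e ∈ M | v ∈ e}.card = 1}

/-- The sockuence value `x_k(M)`: the number of edges of `M` with one endpoint among the first `k`
vertices and the other endpoint among the remaining ones. -/
def sockValue {n : ℕ} (M : Finset (Finset (Fin (2 * n)))) (k : ℕ) : ℕ :=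
  {e ∈ M | ∃ i ∈ e, ∃ j ∈ e, i.val < k ∧ k ≤ j.val}.card

/-- The average value of the sockuence of `M`, that is `(x_1 + ⋯ + x_{2n}) / (2n)`. -/
noncomputable def avgSockValue {n : ℕ} (M : Finset (Finset (Fin (2 * n)))) : ℝ :=
  (∑ k ∈ Finset.Icc 1 (2 * n), (sockValue M k : ℝ)) / (2 * n)

/-- The expectation of `f` at a uniformly random perfect matching of `[2n]`. -/
noncomputable def expect (n : ℕ) (f : Finset (Finset (Fin (2 * n))) → ℝ) : ℝ :=
  (∑ M ∈ perfectMatchings n, f M) / (perfectMatchings n).card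

open Classical in
/-- The probability that a uniformly random perfect matching of `[2n]` has the property `A`. -/
noncomputable def prob (n : ℕ) (A : Finset (Finset (Fin (2 * n))) → Prop) : ℝ :=
  ({M ∈ perfectMatchings n | A M}.card : ℝ) / (perfectMatchings n).card

end Sockuence

namespace Sockuence

open Finset

/-! An edge `{a, b}` crosses exactly `|a - b|` of the cuts `k`, so the average is a linear
statistic: `1 / (4n)` times the sum of `|a - b| * adj M a b` over ordered pairs (`avgSockValue_eq`).
The uniform law is invariant under relabelling vertices, so a given pair is matched with probability
`1 / (2n - 1)` and two given disjoint pairs with probability `1 / ((2n - 1)(2n - 3))`. The first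
gives the mean, via `sum_abs_sub`. Both give the second moment of any symmetric weight
(`expect_weight_sq`), hence variance at most `4n` for the average; Chebyshev's inequality at scale
`√n` then gives concentration. -/

/-- The indicator that `a` and `b` are matched in `M`. -/
def adj {n : ℕ} (M : Finset (Finset (Fin (2 * n)))) (a b : Fin (2 * n)) : ℝ :=
  if ({a, b} : Finset (Fin (2 * n))) ∈ M then 1 else 0

/-! ### Matched pairs, and existence of a perfect matching -/

lemma adj_comm {n : ℕ} (M : Finset (Finset (Fin (2 * n)))) (a b : Fin (2 * n)) :
    adj M a b = adj M b a := by
  rw [adj, adj, Finset.pair_comm]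

lemma adj_mul_self {n : ℕ} (M : Finset (Finset (Fin (2 * n)))) (a b : Fin (2 * n)) :
    adj M a b * adj M a b = adj M a b := by
  unfold adj; split_ifs <;> simp

lemma mem_perfectMatchings {n : ℕ} {M : Finset (Finset (Fin (2 * n)))} :
    M ∈ perfectMatchings n ↔
      (∀ e ∈ M, e.card = 2) ∧ ∀ v : Fin (2 * n), {e ∈ M | v ∈ e}.card = 1 := by
  simp [perfectMatchings]

lemma eq_of_mem_of_mem {n : ℕ} {M : Finset (Finset (Fin (2 * n)))} (hM : M ∈ perfectMatchings n)
    {e f : Finset (Fin (2 * n))} (he : e ∈ M) (hf : f ∈ M) {v : Fin (2 * n)} (hve : v ∈ e)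
    (hvf : v ∈ f) : e = f :=
  Finset.card_le_one.1 ((mem_perfectMatchings.1 hM).2 v).le e (by simp [he, hve]) f
    (by simp [hf, hvf])

lemma exists_partner {n : ℕ} {M : Finset (Finset (Fin (2 * n)))} (hM : M ∈ perfectMatchings n)
    (a : Fin (2 * n)) : ∃ b, b ≠ a ∧ ∀ c, ({a, c} : Finset (Fin (2 * n))) ∈ M ↔ c = b := by
  obtain ⟨e, he⟩ := Finset.card_eq_one.1 ((mem_perfectMatchings.1 hM).2 a)
  have he' : e ∈ M ∧ a ∈ e := by
    have : e ∈ ({e ∈ M | a ∈ e} : Finset _) := by rw [he]; simp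
    simpa using this
  obtain ⟨x, y, hxy, rfl⟩ := Finset.card_eq_two.1 ((mem_perfectMatchings.1 hM).1 e he'.1)
  have key : ∀ b, b ≠ a → ({a, b} : Finset (Fin (2 * n))) ∈ M →
      ∃ b, b ≠ a ∧ ∀ c, ({a, c} : Finset (Fin (2 * n))) ∈ M ↔ c = b := by
    intro b hb hab
    refine ⟨b, hb, fun c => ⟨fun hc => ?_, fun hc => hc ▸ hab⟩⟩
    have h := eq_of_mem_of_mem hM hab hc (v := a) (by simp) (by simp)
    have hb' : b ∈ ({a, c} : Finset (Fin (2 * n))) := h ▸ by simp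
    simp only [Finset.mem_insert, Finset.mem_singleton] at hb'
    tauto
  have ha := he'.2
  simp only [Finset.mem_insert, Finset.mem_singleton] at ha
  rcases ha with rfl | rfl
  · exact key y hxy.symm he'.1
  · exact key x hxy (Finset.pair_comm x a ▸ he'.1)

lemma adj_self {n : ℕ} {M : Finset (Finset (Fin (2 * n)))} (hM : M ∈ perfectMatchings n)
    (a : Fin (2 * n)) : adj M a a = 0 := by
  obtain ⟨b, hb, h⟩ := exists_partner hM a
  rw [adj, if_neg]
  rw [h]; exact hb.symm

lemma sum_adj {n : ℕ} {M : Finset (Finset (Fin (2 * n)))} (hM : M ∈ perfectMatchings n)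
    (a : Fin (2 * n)) : ∑ b, adj M a b = 1 := by
  obtain ⟨b, hb, h⟩ := exists_partner hM a
  simp [adj, h]

lemma adj_mul_adj_of_ne {n : ℕ} {M : Finset (Finset (Fin (2 * n)))}
    (hM : M ∈ perfectMatchings n) (a : Fin (2 * n)) {b c : Fin (2 * n)} (hbc : b ≠ c) :
    adj M a b * adj M a c = 0 := by
  obtain ⟨x, hx, h⟩ := exists_partner hM a
  simp only [adj, h]
  split_ifs with h1 h2
  · exact absurd (h1.trans h2.symm) hbc
  all_goals simp

lemma perfectMatchings_nonempty (n : ℕ) : (perfectMatchings n).Nonempty := by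
  have hrev : ∀ v : Fin (2 * n), v ≠ v.rev := by
    intro v h
    have := congrArg Fin.val h
    rw [Fin.val_rev] at this
    omega
  -- Match each vertex with its mirror image; `v` and `v.rev` sum to the odd number `2n - 1`, so
  -- they differ.
  refine ⟨Finset.univ.image fun v : Fin (2 * n) => {v, v.rev}, mem_perfectMatchings.2 ⟨?_, ?_⟩⟩
  · intro e he
    obtain ⟨v, -, rfl⟩ := Finset.mem_image.1 he
    exact Finset.card_pair (hrev v)
  · intro v
    refine Finset.card_eq_one.2 ⟨{v, v.rev}, ?_⟩
    ext e
    simp only [Finset.mem_filter, Finset.mem_image, Finset.mem_univ, true_and,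
      Finset.mem_singleton]
    constructor
    · rintro ⟨⟨u, rfl⟩, hv⟩
      simp only [Finset.mem_insert, Finset.mem_singleton] at hv
      rcases hv with rfl | rfl
      · rfl
      · rw [Fin.rev_rev, Finset.pair_comm]
    · rintro rfl
      exact ⟨⟨v, rfl⟩, by simp⟩

/-! ### Invariance under relabelling the vertices -/

/-- The action of a permutation of the vertices on sets of edges. -/
def relabel {n : ℕ} (σ : Equiv.Perm (Fin (2 * n))) :
    Finset (Finset (Fin (2 * n))) ≃ Finset (Finset (Fin (2 * n))) :=
  σ.finsetCongr.finsetCongr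

lemma map_mem_relabel {n : ℕ} (σ : Equiv.Perm (Fin (2 * n))) (M : Finset (Finset (Fin (2 * n))))
    (e : Finset (Fin (2 * n))) : e.map σ.toEmbedding ∈ relabel σ M ↔ e ∈ M :=
  Finset.mem_map' (f := σ.finsetCongr.toEmbedding)

lemma adj_relabel {n : ℕ} (σ : Equiv.Perm (Fin (2 * n))) (M : Finset (Finset (Fin (2 * n))))
    (a b : Fin (2 * n)) : adj (relabel σ M) (σ a) (σ b) = adj M a b := by
  have h := map_mem_relabel σ M {a, b}
  rw [Finset.map_insert, Finset.map_singleton] at h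
  simp only [adj]
  exact if_congr h rfl rfl

lemma relabel_mem {n : ℕ} (σ : Equiv.Perm (Fin (2 * n))) {M : Finset (Finset (Fin (2 * n)))}
    (hM : M ∈ perfectMatchings n) : relabel σ M ∈ perfectMatchings n := by
  obtain ⟨h2, h1⟩ := mem_perfectMatchings.1 hM
  refine mem_perfectMatchings.2 ⟨?_, ?_⟩
  · intro e he
    obtain ⟨f, hf, rfl⟩ := Finset.mem_map.1 he
    simpa using h2 f hf
  · intro v
    rw [← h1 (σ.symm v), relabel, Equiv.finsetCongr_apply, Finset.filter_map, Finset.card_map]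
    congr 1
    ext e
    simp [Finset.mem_map_equiv]

lemma relabel_mem_iff {n : ℕ} (σ : Equiv.Perm (Fin (2 * n)))
    (M : Finset (Finset (Fin (2 * n)))) :
    M ∈ perfectMatchings n ↔ relabel σ M ∈ perfectMatchings n := by
  refine ⟨relabel_mem σ, fun h => ?_⟩
  have h' := relabel_mem σ.symm h
  have : relabel σ.symm (relabel σ M) = M := (relabel σ).symm_apply_apply M
  rwa [this] at h'

lemma expect_relabel {n : ℕ} (σ : Equiv.Perm (Fin (2 * n)))
    (f : Finset (Finset (Fin (2 * n))) → ℝ) :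
    expect n (fun M => f (relabel σ M)) = expect n f := by
  unfold expect
  congr 1
  exact Finset.sum_equiv (relabel σ) (relabel_mem_iff σ) fun _ _ => rfl

/-! ### Linearity of the expectation -/

lemma expect_sum {n : ℕ} {ι : Type*} (s : Finset ι)
    (f : ι → Finset (Finset (Fin (2 * n))) → ℝ) :
    expect n (fun M => ∑ i ∈ s, f i M) = ∑ i ∈ s, expect n (f i) := by
  unfold expect
  rw [Finset.sum_comm, Finset.sum_div]

lemma expect_const_mul {n : ℕ} (c : ℝ) (f : Finset (Finset (Fin (2 * n))) → ℝ) :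
    expect n (fun M => c * f M) = c * expect n f := by
  unfold expect
  rw [← Finset.mul_sum, mul_div_assoc]

lemma expect_congr {n : ℕ} {f g : Finset (Finset (Fin (2 * n))) → ℝ}
    (h : ∀ M ∈ perfectMatchings n, f M = g M) : expect n f = expect n g := by
  unfold expect
  rw [Finset.sum_congr rfl h]

lemma card_pos (n : ℕ) : (0 : ℝ) < (perfectMatchings n).card := by
  exact_mod_cast (perfectMatchings_nonempty n).card_pos

lemma expect_const (n : ℕ) (c : ℝ) : expect n (fun _ => c) = c := by
  unfold expect
  rw [Finset.sum_const, nsmul_eq_mul, mul_div_cancel_left₀ _ (card_pos n).ne']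

lemma expect_add {n : ℕ} (f g : Finset (Finset (Fin (2 * n))) → ℝ) :
    expect n (fun M => f M + g M) = expect n f + expect n g := by
  unfold expect
  rw [Finset.sum_add_distrib, add_div]

/-! ### Joint probabilities of edges -/

/-- The symmetric group is 2-transitive, and relabelling preserves the expectation. -/
lemma expect_adj_eq {n : ℕ} {a b c d : Fin (2 * n)} (hab : a ≠ b) (hcd : c ≠ d) :
    expect n (fun M => adj M a b) = expect n (fun M => adj M c d) := by
  have hinj : ∀ {x y : Fin (2 * n)}, x ≠ y → Function.Injective ![x, y] := by
    intro x y h i j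
    fin_cases i <;> fin_cases j <;> simp [h, h.symm]
  obtain ⟨σ, hσ⟩ := (Equiv.Perm.isMultiplyPretransitive (Fin (2 * n)) 2).exists_smul_eq
    ⟨![a, b], hinj hab⟩ ⟨![c, d], hinj hcd⟩
  have h0 : σ a = c := DFunLike.congr_fun hσ 0
  have h1 : σ b = d := DFunLike.congr_fun hσ 1
  rw [← expect_relabel σ (fun M => adj M c d), ← h0, ← h1]
  simp only [adj_relabel]

/-- The partner of `a` is one of `2n - 1` equally likely vertices. -/
lemma expect_adj {n : ℕ} {a b : Fin (2 * n)} (hab : a ≠ b) :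
    expect n (fun M => adj M a b) = 1 / (2 * n - 1) := by
  have h : ∑ c, expect n (fun M => adj M a c) = 1 := by
    rw [← expect_sum, expect_congr (g := fun _ => 1) fun M hM => sum_adj hM a, expect_const]
  have hs : expect n (fun M => adj M a a) = 0 := by
    rw [expect_congr (g := fun _ => 0) fun M hM => adj_self hM a, expect_const]
  rw [← Finset.add_sum_erase _ _ (Finset.mem_univ a), hs, zero_add,
    Finset.sum_congr rfl (g := fun _ => expect n (fun M => adj M a b))
      (fun c hc => expect_adj_eq (Finset.ne_of_mem_erase hc).symm hab),
    Finset.sum_const, Finset.card_erase_of_mem (Finset.mem_univ a), Finset.card_univ,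
    Fintype.card_fin, nsmul_eq_mul] at h
  have hn : 1 ≤ 2 * n := by have := a.2; omega
  push_cast [hn] at h
  exact eq_one_div_of_mul_eq_one_right h

lemma expect_adj_mul_adj_eq {n : ℕ} {x y : Fin 4 → Fin (2 * n)} (hx : Function.Injective x)
    (hy : Function.Injective y) :
    expect n (fun M => adj M (x 0) (x 1) * adj M (x 2) (x 3)) =
      expect n (fun M => adj M (y 0) (y 1) * adj M (y 2) (y 3)) := by
  obtain ⟨σ, hσ⟩ := (Equiv.Perm.isMultiplyPretransitive (Fin (2 * n)) 4).exists_smul_eq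
    ⟨x, hx⟩ ⟨y, hy⟩
  have h (i : Fin 4) : σ (x i) = y i := DFunLike.congr_fun hσ i
  rw [← expect_relabel σ (fun M => adj M (y 0) (y 1) * adj M (y 2) (y 3))]
  simp only [← h, adj_relabel]

/-- Once `a` and `b` are matched, the partner of `c` is one of the `2n - 3` remaining vertices,
equally likely by 4-transitivity. -/
lemma expect_adj_mul_adj_of_disjoint {n : ℕ} {a b c d : Fin (2 * n)} (hab : a ≠ b) (hac : a ≠ c)
    (had : a ≠ d) (hbc : b ≠ c) (hbd : b ≠ d) (hcd : c ≠ d) :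
    expect n (fun M => adj M a b * adj M c d) = 1 / ((2 * n - 1) * (2 * n - 3)) := by
  have hinj : ∀ {e : Fin (2 * n)}, a ≠ e → b ≠ e → c ≠ e → Function.Injective ![a, b, c, e] := by
    intro e h1 h2 h3 i j
    fin_cases i <;> fin_cases j <;>
      simp [*, hab.symm, hac.symm, hbc.symm, h1.symm, h2.symm, h3.symm]
  have h : ∑ e, expect n (fun M => adj M a b * adj M c e) = 1 / (2 * n - 1) := by
    rw [← expect_sum, ← expect_adj hab]
    refine expect_congr fun M hM => ?_
    rw [← Finset.mul_sum, sum_adj hM, mul_one]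
  have hz : ∀ e ∈ ({a, b, c} : Finset (Fin (2 * n))),
      expect n (fun M => adj M a b * adj M c e) = 0 := by
    intro e he
    rw [← expect_const n 0]
    refine expect_congr fun M hM => ?_
    simp only [Finset.mem_insert, Finset.mem_singleton] at he
    rcases he with rfl | rfl | rfl
    · rw [adj_comm M c, adj_mul_adj_of_ne hM _ hbc]
    · rw [adj_comm M a, adj_comm M c, adj_mul_adj_of_ne hM _ hac]
    · rw [adj_self hM, mul_zero]
  have hcard : ({a, b, c} : Finset (Fin (2 * n))).card = 3 := Finset.card_eq_three.2
    ⟨a, b, c, hab, hac, hbc, rfl⟩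
  have hn : 3 ≤ 2 * n := by
    have := Finset.card_le_univ ({a, b, c} : Finset (Fin (2 * n)))
    rwa [hcard, Fintype.card_fin] at this
  rw [← Finset.sum_add_sum_compl {a, b, c}, Finset.sum_eq_zero hz, zero_add,
    Finset.sum_congr rfl (g := fun _ => expect n (fun M => adj M a b * adj M c d)),
    Finset.sum_const, Finset.card_compl, hcard, Fintype.card_fin, nsmul_eq_mul] at h
  · push_cast [hn] at h
    have h3 : (2 * (n : ℝ) - 3) ≠ 0 := by
      intro h0
      have : (2 * n : ℝ) = 3 := by linarith
      norm_cast at this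
      omega
    rw [← div_div, eq_div_iff h3, mul_comm, h]
  · intro e he
    simp only [Finset.mem_compl, Finset.mem_insert, Finset.mem_singleton, not_or] at he
    exact expect_adj_mul_adj_eq (x := ![a, b, c, e]) (y := ![a, b, c, d])
      (hinj (Ne.symm he.1) (Ne.symm he.2.1) (Ne.symm he.2.2)) (hinj had hbd hcd)

/-- One formula for all coincidence patterns, ready to be summed against weights. A single shared
vertex cancels the `1`; two shared vertices turn it into `-1`, which the last term corrects to `1 /
(2n - 1)`. -/
lemma expect_adj_mul_adj {n : ℕ} {a b c d : Fin (2 * n)} (hab : a ≠ b) (hcd : c ≠ d) :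
    expect n (fun M => adj M a b * adj M c d) =
      1 / ((2 * n - 1) * (2 * n - 3)) * (1 - (if a = c then 1 else 0) - (if b = c then 1 else 0)
        - (if a = d then 1 else 0) - (if b = d then 1 else 0))
      + (1 / (2 * n - 1) + 1 / ((2 * n - 1) * (2 * n - 3))) *
        ((if a = c then if b = d then 1 else 0 else 0)
          + (if b = c then if a = d then 1 else 0 else 0)) := by
  have hz : ∀ {x y z : Fin (2 * n)}, y ≠ z →
      expect n (fun M => adj M x y * adj M x z) = 0 := by
    intro x y z h
    rw [← expect_const n 0]
    exact expect_congr fun M hM => adj_mul_adj_of_ne hM _ h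
  by_cases hac : a = c
  · subst hac
    rw [if_neg hab.symm, if_neg hcd]
    by_cases hbd : b = d
    · subst hbd
      simp only [adj_mul_self, expect_adj hab, if_true]
      simp
    · rw [hz hbd]
      simp [hbd]
  by_cases hbc : b = c
  · subst hbc
    rw [if_neg hac, if_neg hcd]
    by_cases had : a = d
    · subst had
      simp only [adj_comm _ b a, adj_mul_self, expect_adj hab, if_true]
      simp
    · simp only [adj_comm _ a b]
      rw [hz had]
      simp [had]
  by_cases had : a = d
  · subst had
    simp only [adj_comm _ c a]
    rw [hz hbc]
    simp [hac, hbc, hab.symm]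
  by_cases hbd : b = d
  · subst hbd
    simp only [adj_comm _ c b, adj_comm _ a b]
    rw [hz hac]
    simp [hac, hbc, had]
  rw [expect_adj_mul_adj_of_disjoint hab hac had hbc hbd hcd]
  simp [*]

/-! ### Moments of weighted matchings -/

lemma expect_weight {n : ℕ} (w : Fin (2 * n) → Fin (2 * n) → ℝ) (hw : ∀ a, w a a = 0) :
    expect n (fun M => ∑ a, ∑ b, w a b * adj M a b) = (∑ a, ∑ b, w a b) / (2 * n - 1) := by
  simp only [expect_sum, expect_const_mul, Finset.sum_div]
  refine Finset.sum_congr rfl fun a _ => Finset.sum_congr rfl fun b _ => ?_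
  by_cases hab : a = b
  · simp [hab, hw]
  · rw [expect_adj hab, mul_one_div]

/-- By symmetry of `w`, each of the four single coincidences sums to the squared row sums, and each
of the two double ones to the squared weights. -/
lemma expect_weight_sq {n : ℕ} (w : Fin (2 * n) → Fin (2 * n) → ℝ) (hw : ∀ a, w a a = 0)
    (hsymm : ∀ a b, w a b = w b a) :
    expect n (fun M => (∑ a, ∑ b, w a b * adj M a b) ^ 2) =
      1 / ((2 * n - 1) * (2 * n - 3)) * ((∑ a, ∑ b, w a b) ^ 2 - 4 * ∑ a, (∑ b, w a b) ^ 2)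
      + (1 / (2 * n - 1) + 1 / ((2 * n - 1) * (2 * n - 3))) * (2 * ∑ a, ∑ b, w a b ^ 2) := by
  set q : ℝ := 1 / ((2 * n - 1) * (2 * n - 3)) with hq
  set r : ℝ := 1 / (2 * n - 1) + q with hr
  have h1 : expect n (fun M => (∑ a, ∑ b, w a b * adj M a b) ^ 2) =
      ∑ a, ∑ b, w a b * ∑ c, ∑ d, w c d * expect n (fun M => adj M a b * adj M c d) := by
    have : ∀ M : Finset (Finset (Fin (2 * n))), (∑ a, ∑ b, w a b * adj M a b) ^ 2 =
        ∑ a, ∑ b, w a b * ∑ c, ∑ d, w c d * (adj M a b * adj M c d) := by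
      intro M
      rw [sq, Finset.sum_mul]
      refine Finset.sum_congr rfl fun a _ => ?_
      rw [Finset.sum_mul]
      refine Finset.sum_congr rfl fun b _ => ?_
      simp only [Finset.mul_sum]
      refine Finset.sum_congr rfl fun c _ => Finset.sum_congr rfl fun d _ => by ring
    simp only [this, expect_sum, expect_const_mul]
  have h2 : ∀ a b, w a b * ∑ c, ∑ d, w c d * expect n (fun M => adj M a b * adj M c d) =
      w a b * (q * ((∑ c, ∑ d, w c d) - 2 * (∑ d, w a d) - 2 * ∑ d, w b d)
        + r * (2 * w a b)) := by
    intro a b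
    by_cases hab : a = b
    · rw [hab, hw, zero_mul, zero_mul]
    congr 1
    have h3 : ∀ c d, w c d * expect n (fun M => adj M a b * adj M c d) =
        q * (w c d - (if a = c then w c d else 0) - (if b = c then w c d else 0)
        - (if a = d then w c d else 0) - (if b = d then w c d else 0))
        + r * ((if a = c then if b = d then w c d else 0 else 0)
          + (if b = c then if a = d then w c d else 0 else 0)) := by
      intro c d
      by_cases hcd : c = d
      · simp [hcd, hw]
      rw [expect_adj_mul_adj hab hcd, ← hq, ← hr]
      split_ifs <;> ring
    simp only [h3, Finset.sum_add_distrib, Finset.sum_sub_distrib, ← Finset.mul_sum]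
    have e1 : ∀ x : Fin (2 * n), (∑ c, ∑ d, if x = c then w c d else 0) = ∑ d, w x d := by
      intro x
      rw [Finset.sum_comm]
      simp
    have e2 : ∀ x : Fin (2 * n), (∑ c, ∑ d, if x = d then w c d else 0) = ∑ d, w x d := by
      intro x
      simp [hsymm x]
    have e3 : ∀ x y : Fin (2 * n),
        (∑ c, ∑ d, if x = c then if y = d then w c d else 0 else 0) = w x y := by
      intro x y
      rw [Finset.sum_comm]
      simp
    rw [e1, e1, e2, e2, e3, e3, hsymm b a]
    ring
  have h4 : ∑ a, ∑ b, w a b * ∑ d, w b d = ∑ a, (∑ b, w a b) ^ 2 := by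
    rw [Finset.sum_comm]
    refine Finset.sum_congr rfl fun a _ => ?_
    rw [← Finset.sum_mul, sq]
    simp only [hsymm a]
  have h5 : ∑ a, ∑ b, w a b * ∑ d, w a d = ∑ a, (∑ b, w a b) ^ 2 := by
    refine Finset.sum_congr rfl fun a _ => ?_
    rw [← Finset.sum_mul, sq]
  rw [h1]
  simp only [h2]
  have h6 : ∀ a b, w a b * (q * ((∑ c, ∑ d, w c d) - 2 * (∑ d, w a d) - 2 * ∑ d, w b d)
        + r * (2 * w a b)) = (q * ∑ c, ∑ d, w c d) * w a b - 2 * q * (w a b * ∑ d, w a d)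
        - 2 * q * (w a b * ∑ d, w b d) + 2 * r * w a b ^ 2 := by
    intro a b; ring
  simp only [h6, Finset.sum_add_distrib, Finset.sum_sub_distrib, ← Finset.mul_sum]
  rw [h4, h5]
  ring

/-- The variance bound for the weight of a random matching. -/
lemma expect_weight_sub_sq_le {n : ℕ} (hn : 2 ≤ n) (w : Fin (2 * n) → Fin (2 * n) → ℝ)
    (hw : ∀ a, w a a = 0) (hsymm : ∀ a b, w a b = w b a) :
    expect n (fun M => (∑ a, ∑ b, w a b * adj M a b - (∑ a, ∑ b, w a b) / (2 * n - 1)) ^ 2) ≤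
      4 / (2 * n - 1) * ∑ a, ∑ b, w a b ^ 2 := by
  set W := ∑ a, ∑ b, w a b with hW
  set Q := ∑ a, ∑ b, w a b ^ 2 with hQ
  have hQ0 : 0 ≤ Q := Finset.sum_nonneg fun a _ => Finset.sum_nonneg fun b _ => sq_nonneg _
  have hn' : (2 : ℝ) ≤ n := by exact_mod_cast hn
  have h1 : ∀ M : Finset (Finset (Fin (2 * n))),
      (∑ a, ∑ b, w a b * adj M a b - W / (2 * n - 1)) ^ 2 =
      (∑ a, ∑ b, w a b * adj M a b) ^ 2
        + ((-2 * (W / (2 * n - 1))) * (∑ a, ∑ b, w a b * adj M a b) + (W / (2 * n - 1)) ^ 2) := by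
    intro M; ring
  simp only [h1]
  rw [expect_add, expect_add, expect_const, expect_const_mul, expect_weight w hw,
    expect_weight_sq w hw hsymm, ← hW, ← hQ]
  -- Cauchy–Schwarz on the row sums: it makes the disjoint-pair contribution at most the squared
  -- mean, so only the `Q` term survives.
  have hcs : W ^ 2 ≤ (2 * n) * ∑ a, (∑ b, w a b) ^ 2 := by
    have := sq_sum_le_card_mul_sum_sq (s := Finset.univ) (f := fun a => ∑ b, w a b)
    simpa using this
  set D := ∑ a, (∑ b, w a b) ^ 2 with hD
  have p1 : (0 : ℝ) < 2 * n - 1 := by linarith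
  have p3 : (0 : ℝ) < 2 * n - 3 := by linarith
  have hD' : W ^ 2 - 4 * D ≤ W ^ 2 * (1 - 4 / (2 * n)) := by
    have : W ^ 2 / (2 * n) ≤ D := by
      rw [div_le_iff₀ (by linarith)]; linarith
    have e : W ^ 2 * (1 - 4 / (2 * n)) = W ^ 2 - 4 * (W ^ 2 / (2 * n)) := by ring
    linarith
  have hA : 1 / ((2 * (n : ℝ) - 1) * (2 * n - 3)) * (W ^ 2 - 4 * D) ≤ W ^ 2 / (2 * n - 1) ^ 2 := by
    calc _ ≤ 1 / ((2 * (n : ℝ) - 1) * (2 * n - 3)) * (W ^ 2 * (1 - 4 / (2 * n))) :=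
          mul_le_mul_of_nonneg_left hD' (by positivity)
      _ = W ^ 2 * ((2 * n - 4) / (2 * n * ((2 * n - 1) * (2 * n - 3)))) := by
          field_simp
      _ ≤ W ^ 2 * (1 / (2 * n - 1) ^ 2) := by
          refine mul_le_mul_of_nonneg_left ?_ (sq_nonneg _)
          rw [div_le_div_iff₀ (by positivity) (by positivity)]
          nlinarith
      _ = _ := by ring
  have hB : (1 / (2 * (n : ℝ) - 1) + 1 / ((2 * n - 1) * (2 * n - 3))) ≤ 2 / (2 * n - 1) := by
    have : 1 / ((2 * (n : ℝ) - 1) * (2 * n - 3)) ≤ 1 / (2 * n - 1) := by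
      refine one_div_le_one_div_of_le p1 ?_
      nlinarith
    calc _ ≤ 1 / (2 * (n : ℝ) - 1) + 1 / (2 * n - 1) := by linarith
      _ = _ := by ring
  have hB' := mul_le_mul_of_nonneg_right hB (mul_nonneg zero_le_two hQ0)
  have e1 : -2 * (W / (2 * n - 1)) * (W / (2 * n - 1)) + (W / (2 * n - 1)) ^ 2 =
      - (W ^ 2 / (2 * n - 1) ^ 2) := by rw [← div_pow]; ring
  have e2 : 2 / (2 * (n : ℝ) - 1) * (2 * Q) = 4 / (2 * n - 1) * Q := by ring
  rw [e1, ← e2]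
  linarith

/-! ### The average sock value as a weight -/

/-- A cut edge has exactly one orientation `(a, b)` with `a < k ≤ b`. -/
lemma sockValue_eq {n : ℕ} {M : Finset (Finset (Fin (2 * n)))} (hM : M ∈ perfectMatchings n)
    (k : ℕ) : (sockValue M k : ℝ) =
      ∑ a : Fin (2 * n), ∑ b : Fin (2 * n), (if a.val < k ∧ k ≤ b.val then adj M a b else 0) := by
  have hcard : sockValue M k = (Finset.univ.filter fun p : Fin (2 * n) × Fin (2 * n) =>
      (p.1.val < k ∧ k ≤ p.2.val) ∧ ({p.1, p.2} : Finset (Fin (2 * n))) ∈ M).card := by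
    refine (Finset.card_bij (fun p _ => {p.1, p.2}) ?_ ?_ ?_).symm
    · rintro ⟨a, b⟩ h
      simp only [Finset.mem_filter, Finset.mem_univ, true_and] at h ⊢
      exact ⟨h.2, a, by simp, b, by simp, h.1⟩
    · rintro ⟨a, b⟩ h ⟨c, d⟩ h' heq
      simp only [Finset.mem_filter, Finset.mem_univ, true_and] at h h' heq
      have ha : a ∈ ({c, d} : Finset (Fin (2 * n))) := heq ▸ by simp
      have hb : b ∈ ({c, d} : Finset (Fin (2 * n))) := heq ▸ by simp
      simp only [Finset.mem_insert, Finset.mem_singleton] at ha hb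
      have h1 : a = c := ha.resolve_right (by rintro rfl; omega)
      have h2 : b = d := hb.resolve_left (by rintro rfl; omega)
      rw [h1, h2]
    · intro e he
      obtain ⟨heM, i, hi, j, hj, hij⟩ := Finset.mem_filter.1 he
      have hne : i ≠ j := by rintro rfl; omega
      have hsub : ({i, j} : Finset (Fin (2 * n))) = e := by
        refine Finset.eq_of_subset_of_card_le ?_ ?_
        · intro x hx
          simp only [Finset.mem_insert, Finset.mem_singleton] at hx
          rcases hx with rfl | rfl <;> assumption
        · rw [(mem_perfectMatchings.1 hM).1 e heM, Finset.card_pair hne]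
      refine ⟨(i, j), ?_, hsub⟩
      simp only [Finset.mem_filter, Finset.mem_univ, true_and]
      exact ⟨hij, hsub ▸ heM⟩
  rw [hcard, ← Finset.sum_product', Finset.univ_product_univ, Finset.card_filter]
  push_cast
  refine Finset.sum_congr rfl fun p _ => ?_
  simp only [adj, ite_and]

lemma avgSockValue_eq {n : ℕ} {M : Finset (Finset (Fin (2 * n)))} (hM : M ∈ perfectMatchings n) :
    avgSockValue M = (∑ a : Fin (2 * n), ∑ b : Fin (2 * n),
      |(a.val : ℝ) - b.val| * adj M a b) / (2 * (2 * n)) := by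
  have h1 : ∑ k ∈ Finset.Icc 1 (2 * n), (sockValue M k : ℝ) =
      ∑ a : Fin (2 * n), ∑ b : Fin (2 * n), ((b.val - a.val : ℕ) : ℝ) * adj M a b := by
    simp only [sockValue_eq hM]
    rw [Finset.sum_comm]
    refine Finset.sum_congr rfl fun a _ => ?_
    rw [Finset.sum_comm]
    refine Finset.sum_congr rfl fun b _ => ?_
    rw [← Finset.sum_filter, Finset.sum_const, nsmul_eq_mul]
    -- The cuts separating `a < b` are the `k` in `(a, b]`; truncated subtraction gives `0` for the
    -- other orientation.
    congr 2
    have : {k ∈ Finset.Icc 1 (2 * n) | a.val < k ∧ k ≤ b.val} = Finset.Ioc a.val b.val := by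
      ext k
      simp only [Finset.mem_filter, Finset.mem_Icc, Finset.mem_Ioc]
      omega
    rw [this, Nat.card_Ioc]
  have h2 : ∑ a : Fin (2 * n), ∑ b : Fin (2 * n), ((b.val - a.val : ℕ) : ℝ) * adj M a b =
      ∑ a : Fin (2 * n), ∑ b : Fin (2 * n), ((a.val - b.val : ℕ) : ℝ) * adj M a b := by
    rw [Finset.sum_comm]
    refine Finset.sum_congr rfl fun a _ => Finset.sum_congr rfl fun b _ => ?_
    rw [adj_comm]
  have h3 : ∑ a : Fin (2 * n), ∑ b : Fin (2 * n), |(a.val : ℝ) - b.val| * adj M a b =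
      2 * ∑ a : Fin (2 * n), ∑ b : Fin (2 * n), ((b.val - a.val : ℕ) : ℝ) * adj M a b := by
    have h4 : 2 * ∑ a : Fin (2 * n), ∑ b : Fin (2 * n), ((b.val - a.val : ℕ) : ℝ) * adj M a b =
        ∑ a : Fin (2 * n), ∑ b : Fin (2 * n), ((b.val - a.val : ℕ) : ℝ) * adj M a b +
        ∑ a : Fin (2 * n), ∑ b : Fin (2 * n), ((a.val - b.val : ℕ) : ℝ) * adj M a b := by
      linarith
    rw [h4]
    simp only [← Finset.sum_add_distrib]
    refine Finset.sum_congr rfl fun a _ => Finset.sum_congr rfl fun b _ => ?_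
    rw [← add_mul]
    congr 1
    rcases le_total a.val b.val with h | h
    · have h' : (a.val : ℝ) ≤ b.val := by exact_mod_cast h
      rw [Nat.sub_eq_zero_of_le h, Nat.cast_sub h, abs_of_nonpos (by linarith)]
      simp
    · have h' : (b.val : ℝ) ≤ a.val := by exact_mod_cast h
      rw [Nat.sub_eq_zero_of_le h, Nat.cast_sub h, abs_of_nonneg (by linarith)]
      simp
  rw [avgSockValue, h1, h3, mul_div_mul_left _ _ two_ne_zero]

lemma sum_range_sub (N : ℕ) : ∑ a ∈ Finset.range N, ((N : ℝ) - a) = N * (N + 1) / 2 := by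
  induction N with
  | zero => simp
  | succ N ih =>
    rw [Finset.sum_range_succ]
    have : ∀ a ∈ Finset.range N, (((N + 1 : ℕ) : ℝ) - a) = ((N : ℝ) - a) + 1 := by
      intro a _; push_cast; ring
    rw [Finset.sum_congr rfl this, Finset.sum_add_distrib, ih]
    simp
    ring

/-- Going from `N` to `N + 1` points adds a row and a column, each of sum `N (N + 1) / 2`. -/
lemma sum_abs_sub (N : ℕ) : ∑ a : Fin N, ∑ b : Fin N, |(a.val : ℝ) - b.val| =
    N * (N - 1) * (N + 1) / 3 := by
  have h : ∑ a : Fin N, ∑ b : Fin N, |(a.val : ℝ) - b.val| =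
      ∑ a ∈ Finset.range N, ∑ b ∈ Finset.range N, |(a : ℝ) - b| := by
    rw [← Fin.sum_univ_eq_sum_range (fun a => ∑ b ∈ Finset.range N, |(a : ℝ) - b|) N]
    refine Finset.sum_congr rfl fun a _ => ?_
    rw [← Fin.sum_univ_eq_sum_range (fun b => |(a.val : ℝ) - b|) N]
  rw [h]
  clear h
  induction N with
  | zero => simp
  | succ N ih =>
    have e1 : ∑ a ∈ Finset.range N, |(a : ℝ) - N| = N * (N + 1) / 2 := by
      rw [← sum_range_sub]
      refine Finset.sum_congr rfl fun a ha => ?_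
      have : (a : ℝ) ≤ N := by exact_mod_cast (Finset.mem_range.1 ha).le
      rw [abs_of_nonpos (by linarith), neg_sub]
    have e2 : ∑ a ∈ Finset.range N, |(N : ℝ) - a| = N * (N + 1) / 2 := by
      rw [← e1]
      exact Finset.sum_congr rfl fun a _ => abs_sub_comm _ _
    rw [Finset.sum_range_succ]
    simp only [Finset.sum_range_succ, Finset.sum_add_distrib]
    rw [ih, e1, e2]
    simp
    ring

lemma expect_avgSockValue {n : ℕ} (hn : 1 ≤ n) :
    expect n (fun M => avgSockValue M) = (2 * (n : ℝ) + 1) / 6 := by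
  have hn' : (1 : ℝ) ≤ n := by exact_mod_cast hn
  have p1 : (2 * (n : ℝ) - 1) ≠ 0 := by linarith
  rw [expect_congr (g := fun M => (1 / (2 * (2 * n))) * (∑ a : Fin (2 * n), ∑ b : Fin (2 * n),
      |(a.val : ℝ) - b.val| * adj M a b)) fun M hM => by rw [avgSockValue_eq hM]; ring,
    expect_const_mul, expect_weight (fun a b => |(a.val : ℝ) - b.val|) (by simp), sum_abs_sub]
  push_cast
  field_simp
  ring

lemma expect_avgSockValue_sub_sq_le {n : ℕ} (hn : 2 ≤ n) :
    expect n (fun M => (avgSockValue M - (2 * (n : ℝ) + 1) / 6) ^ 2) ≤ 4 * n := by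
  have hn' : (2 : ℝ) ≤ n := by exact_mod_cast hn
  have p1 : (0 : ℝ) < 2 * n - 1 := by linarith
  have h := expect_weight_sub_sq_le hn (fun a b => |(a.val : ℝ) - b.val|) (by simp)
    (fun a b => abs_sub_comm _ _)
  have hQ : ∑ a : Fin (2 * n), ∑ b : Fin (2 * n), |(a.val : ℝ) - b.val| ^ 2 ≤
      (2 * n) * ((2 * n) * (2 * n) ^ 2) := by
    have hab : ∀ a b : Fin (2 * n), |(a.val : ℝ) - b.val| ^ 2 ≤ (2 * n : ℝ) ^ 2 := by
      intro a b
      have ha : (a.val : ℝ) ≤ 2 * n := by exact_mod_cast a.2.le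
      have hb : (b.val : ℝ) ≤ 2 * n := by exact_mod_cast b.2.le
      have ha0 : (0 : ℝ) ≤ a.val := Nat.cast_nonneg _
      have hb0 : (0 : ℝ) ≤ b.val := Nat.cast_nonneg _
      exact pow_le_pow_left₀ (abs_nonneg _) (abs_le.2 ⟨by linarith, by linarith⟩) 2
    calc _ ≤ ∑ a : Fin (2 * n), ∑ b : Fin (2 * n), (2 * n : ℝ) ^ 2 :=
          Finset.sum_le_sum fun a _ => Finset.sum_le_sum fun b _ => hab a b
      _ = _ := by simp
  rw [sum_abs_sub] at h
  rw [expect_congr (g := fun M => (1 / (2 * (2 * n))) ^ 2 * (∑ a : Fin (2 * n), ∑ b : Fin (2 * n),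
      |(a.val : ℝ) - b.val| * adj M a b -
      ((2 * n : ℕ) : ℝ) * (((2 * n : ℕ) : ℝ) - 1) * (((2 * n : ℕ) : ℝ) + 1) / 3
        / (2 * n - 1)) ^ 2), expect_const_mul]
  · have h' := h.trans (mul_le_mul_of_nonneg_left hQ (by positivity))
    -- Bounding every squared length by `(2n)²` leaves `4n² / (2n - 1)`, at most `4n` because `n ≤
    -- 2n - 1`.
    refine (mul_le_mul_of_nonneg_left h' (by positivity)).trans ?_
    have e : (1 / (2 * (2 * (n : ℝ)))) ^ 2 * (4 / (2 * n - 1) * (2 * n * (2 * n * (2 * n) ^ 2))) =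
        4 * n ^ 2 / (2 * n - 1) := by
      field_simp
    rw [e, div_le_iff₀ p1]
    nlinarith
  · intro M hM
    rw [avgSockValue_eq hM, ← mul_pow]
    congr 1
    push_cast
    field_simp
    ring

/-! ### Concentration -/

lemma prob_le_one (n : ℕ) (A : Finset (Finset (Fin (2 * n))) → Prop) : prob n A ≤ 1 := by
  classical
  unfold prob
  rw [div_le_one (card_pos n)]
  exact Nat.cast_le.2 (Finset.card_filter_le _ _)

/-- Chebyshev's inequality for a random perfect matching. -/
lemma one_sub_le_prob {n : ℕ} (f : Finset (Finset (Fin (2 * n))) → ℝ) (m : ℝ) {t : ℝ}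
    (ht : 0 < t) {A : Finset (Finset (Fin (2 * n))) → Prop} (hA : ∀ M, |f M - m| ≤ t → A M) :
    1 - expect n (fun M => (f M - m) ^ 2) / t ^ 2 ≤ prob n A := by
  classical
  have hc := card_pos n
  have h : ((perfectMatchings n).card : ℝ) - (∑ M ∈ perfectMatchings n, (f M - m) ^ 2) / t ^ 2 ≤
      ((perfectMatchings n).filter A).card := by
    rw [Finset.card_filter, Finset.sum_div, Finset.cast_card, Nat.cast_sum,
      ← Finset.sum_sub_distrib]
    -- Pointwise, `1 - (f M - m)² / t²` is at most the indicator of `A`.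
    refine Finset.sum_le_sum fun M _ => ?_
    split_ifs with hM
    · have : 0 ≤ (f M - m) ^ 2 / t ^ 2 := by positivity
      push_cast
      linarith
    · have : t < |f M - m| := not_le.1 fun h => hM (hA M h)
      have h2 : t ^ 2 ≤ (f M - m) ^ 2 := by
        rw [← sq_abs (f M - m)]
        exact pow_le_pow_left₀ ht.le this.le 2
      have h3 : 1 ≤ (f M - m) ^ 2 / t ^ 2 := (one_le_div (by positivity)).2 h2
      push_cast
      linarith
  have e : 1 - expect n (fun M => (f M - m) ^ 2) / t ^ 2 =
      (((perfectMatchings n).card : ℝ) - (∑ M ∈ perfectMatchings n, (f M - m) ^ 2) / t ^ 2) /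
        (perfectMatchings n).card := by
    unfold expect
    field_simp
  rw [e, prob]
  refine div_le_div_of_nonneg_right (h.trans (le_of_eq ?_)) hc.le
  congr!

/-- The mean exceeds `n / 3` by `1 / 6 ≤ √n`; recentring costs one unit of `x`. -/
lemma one_sub_le_prob_avgSockValue {n : ℕ} (hn : 2 ≤ n) {x : ℝ} (hx : 1 < x) :
    1 - 4 / (x - 1) ^ 2 ≤
      prob n (fun M => |avgSockValue M - (n : ℝ) / 3| ≤ x * Real.sqrt n) := by
  have hn' : (2 : ℝ) ≤ n := by exact_mod_cast hn
  have hs : 1 ≤ Real.sqrt n := Real.one_le_sqrt.2 (by linarith)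
  have hx' : 0 < x - 1 := by linarith
  have ht : 0 < (x - 1) * Real.sqrt n := by positivity
  refine le_trans ?_ (one_sub_le_prob (fun M => avgSockValue M) ((2 * (n : ℝ) + 1) / 6) ht ?_)
  · have h := div_le_div_of_nonneg_right (expect_avgSockValue_sub_sq_le hn)
      (sq_nonneg ((x - 1) * Real.sqrt n))
    have e : 4 * (n : ℝ) / ((x - 1) * Real.sqrt n) ^ 2 = 4 / (x - 1) ^ 2 := by
      rw [mul_pow, Real.sq_sqrt (by linarith)]
      field_simp
    rw [e] at h
    linarith
  · intro M hM
    rw [abs_le] at hM ⊢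
    constructor <;> nlinarith [hM.1, hM.2]

end Sockuence

theorem theorem1 :
    (∀ n : ℕ, 1 ≤ n →
      Sockuence.expect n (fun M => Sockuence.avgSockValue M) = (2 * (n : ℝ) + 1) / 6) ∧
    (∀ ω : ℕ → ℝ, Tendsto ω atTop atTop →
      Tendsto
        (fun n : ℕ => Sockuence.prob n
          (fun M => |Sockuence.avgSockValue M - (n : ℝ) / 3| ≤ ω n * Real.sqrt (n : ℝ)))
        atTop (𝓝 1)) := by
  refine ⟨fun n hn => Sockuence.expect_avgSockValue hn, fun ω hω => ?_⟩
  have hlim : Tendsto (fun n => 1 - 4 / (ω n - 1) ^ 2) atTop (𝓝 1) := by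
    have h1 : Tendsto (fun n => (ω n - 1) ^ 2) atTop atTop :=
      (tendsto_pow_atTop two_ne_zero).comp (tendsto_atTop_add_const_right _ (-1) hω)
    simpa using (h1.const_div_atTop 4).const_sub 1
  refine tendsto_of_tendsto_of_tendsto_of_le_of_le' hlim tendsto_const_nhds ?_
    (Eventually.of_forall fun n => Sockuence.prob_le_one n _)
  filter_upwards [eventually_ge_atTop 2, hω.eventually_gt_atTop 1] with n hn hx
  exact Sockuence.one_sub_le_prob_avgSockValue hn hx
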